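/- Let $M_1,M_2$ be smooth manifolds (without boundary) of dimensions $m_1\ge 0$ and $m_2\ge 1$, and let $T\subseteq\mathbb R$ be a set of times. For each $t\in T$ let $g_1(\cdot,t)$ and $g_2(\cdot,t)$ be smooth Riemannian metrics on $M_1$ and $M_2$, let $\lambda(\cdot,t):M_1\to(0,\infty)$ be smooth, and let $$\bar g(x,y,t)=g_1(x,t)\oplus\lambda^2(x,t)\,g_2(y,t)$$ be the warped product metric on $M_1\times M_2$, that is $\bar g(X,Y)=g_1(d\pi_1X,d\pi_1Y)+\lambda^2 g_2(d\pi_2X,d\pi_2Y)$, where $\pi_1,\pi_2$ are the projections onto the factors. Suppose that $g_2$ is an Einstein metric with constant $c\in\mathbb R$: ${}^{M_2}\mathrm{Ric}=c\,g_2$ for all $t\in T$. Then there is a function $f:M_1\times T\to\mathbb R$ such that the vertical components of the Ricci tensor $\overline{\mathrm{Ric}}$ of $\bar g$ satisfy $$\overline{\mathrm{Ric}}_{\alpha\beta}=f(x,t)\,\bar g_{\alpha\beta},$$ i.e. $\overline{\mathrm{Ric}}\big((0,V),(0,W)\big)=f(x,t)\,\bar g\big((0,V),(0,W)\big)$ for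 all $x\in M_1$, $y\in M_2$, $t\in T$ and $V,W\in T_yM_2$. Moreover $$f=\frac1{m_2}\sum_{\alpha,\beta=1}^{m_2}\bar g^{\alpha\beta}\,\overline{\mathrm{Ric}}_{\alpha\beta}$$ at every point $(x,y)$ and time $t$, where for arbitrary bases $(\partial_i)$ of $T_xM_1$ and $(\partial_\alpha)$ of $T_yM_2$ one writes $\overline{\mathrm{Ric}}_{\alpha\beta}=\overline{\mathrm{Ric}}\big((0,\partial_\alpha),(0,\partial_\beta)\big)$ and $(\bar g^{\alpha\beta})$ is the vertical block of the inverse of the matrix of $\bar g$ in the basis $(\partial_i,0),(0,\partial_\alpha)$; and $$f=\frac1{2\lambda^2}\Big((4-2m_2)\,|\mathrm{grad}\,\lambda|^2-\Delta_{M_1}\lambda^2+2c\Big),$$ where $\mathrm{grad}$, $|\cdot|$ and the Laplacian $\Delta_{M_1}=\mathrm{Tr}\,\mathrm{Hess}$ are those of $(M_1,g_1(\cdot,t))$. -/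

import Mathlib

open scoped Manifold ContDiff

set_option maxSynthPendingDepth 3

noncomputable section

namespace RiemGeom

/-- The pullback `(u, v) ↦ B(D u, D v)` of a bilinear form `B` by a linear map `D`. -/
def pullbackForm {V W : Type*} [AddCommGroup V] [Module ℝ V] [TopologicalSpace V]
    [AddCommGroup W] [Module ℝ W] [TopologicalSpace W]
    (B : W →L[ℝ] W →L[ℝ] ℝ) (D : V →L[ℝ] W) : V →L[ℝ] V →L[ℝ] ℝ :=
  (ContinuousLinearMap.precomp ℝ D).comp (B.comp D)

theorem pullbackForm_apply {V W : Type*} [AddCommGroup V] [Module ℝ V] [TopologicalSpace V]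
    [AddCommGroup W] [Module ℝ W] [TopologicalSpace W]
    (B : W →L[ℝ] W →L[ℝ] ℝ) (D : V →L[ℝ] W) (u v : V) :
    pullbackForm B D u v = B (D u) (D v) := rfl

section Chart

variable {E : Type*} [NormedAddCommGroup E] [NormedSpace ℝ E]
  {H : Type*} [TopologicalSpace H] (I : ModelWithCorners ℝ E H)
  {M : Type*} [TopologicalSpace M] [ChartedSpace H M]

/-- A field of bilinear forms on the tangent spaces of `M` (a covariant 2-tensor field). Every
Riemannian metric `g` gives one, namely `g.inner`. -/
abbrev BilinField (M : Type*) [TopologicalSpace M] [ChartedSpace H M] : Type _ :=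
  Π x : M, TangentSpace I x →L[ℝ] TangentSpace I x →L[ℝ] ℝ

variable {I}

/-- The metric read in the chart `φ` at `p`:
`G_z(u, v) = g_{φ⁻¹(z)}(dφ⁻¹_z u, dφ⁻¹_z v)`, i.e. the pullback of `g` by `φ⁻¹`. -/
def chartMetric (g : BilinField I M) (p : M) (z : E) : E →L[ℝ] E →L[ℝ] ℝ :=
  pullbackForm (g ((extChartAt I p).symm z)) (mfderiv 𝓘(ℝ, E) I (extChartAt I p).symm z)

theorem chartMetric_apply (g : BilinField I M) (p : M) (z u v : E) :
    chartMetric g p z u v = g ((extChartAt I p).symm z)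
      (mfderiv 𝓘(ℝ, E) I (extChartAt I p).symm z u)
      (mfderiv 𝓘(ℝ, E) I (extChartAt I p).symm z v) := rfl

/-- The permutation `(u, v, w) ↦ A(w, u, v)` of a trilinear form `A`. -/
def cycleForm (A : E →L[ℝ] E →L[ℝ] E →L[ℝ] ℝ) : E →L[ℝ] E →L[ℝ] E →L[ℝ] ℝ :=
  (ContinuousLinearMap.flipₗᵢ ℝ E E ℝ).toContinuousLinearEquiv.toContinuousLinearMap.comp A.flip

theorem cycleForm_apply (A : E →L[ℝ] E →L[ℝ] E →L[ℝ] ℝ) (u v w : E) :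
    cycleForm A u v w = A w u v := rfl

/-- The Christoffel symbols of the first kind of a metric `G` on (an open subset of) `E`:
`(u, v, w) ↦ ½ (∂_u G(v, w) + ∂_v G(u, w) - ∂_w G(u, v))`. -/
def christoffelLower (G : E → E →L[ℝ] E →L[ℝ] ℝ) (z : E) : E →L[ℝ] E →L[ℝ] E →L[ℝ] ℝ :=
  (1 / 2 : ℝ) • (fderiv ℝ G z + (fderiv ℝ G z).flip - cycleForm (fderiv ℝ G z))

theorem christoffelLower_apply (G : E → E →L[ℝ] E →L[ℝ] ℝ) (z u v w : E) :
    christoffelLower G z u v w =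
      1 / 2 * (fderiv ℝ G z u v w + fderiv ℝ G z v u w - fderiv ℝ G z w u v) := by
  simp [christoffelLower, cycleForm_apply]

/-- The Christoffel symbols of the second kind: `Γ_z(u, v)` is the vector obtained by raising the
last index of the symbols of the first kind, so that `G_z(Γ_z(u, v), ·)` is
`christoffelLower G z u v`. It is the Levi-Civita derivative `∇_u v` of constant fields. -/
def christoffel (G : E → E →L[ℝ] E →L[ℝ] ℝ) (z : E) : E →L[ℝ] E →L[ℝ] E :=
  (ContinuousLinearMap.compL ℝ E (E →L[ℝ] ℝ) E (G z).inverse).comp (christoffelLower G z)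

theorem christoffel_apply (G : E → E →L[ℝ] E →L[ℝ] ℝ) (z u v : E) :
    christoffel G z u v = (G z).inverse (christoffelLower G z u v) := rfl

/-- The curvature endomorphism `u ↦ R(u, v) w` at `z`, where
`R(u, v) w = (∂_u Γ)(v, w) - (∂_v Γ)(u, w) + Γ(u, Γ(v, w)) - Γ(v, Γ(u, w))`
is `∇_u ∇_v w - ∇_v ∇_u w` for constant fields `u, v, w`. -/
def curvatureEnd (G : E → E →L[ℝ] E →L[ℝ] ℝ) (z v w : E) : E →L[ℝ] E :=
  ((fderiv ℝ (christoffel G) z).flip v).flip w - (fderiv ℝ (christoffel G) z v).flip w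
    + (christoffel G z).flip (christoffel G z v w)
    - (christoffel G z v).comp ((christoffel G z).flip w)

theorem curvatureEnd_apply (G : E → E →L[ℝ] E →L[ℝ] ℝ) (z u v w : E) :
    curvatureEnd G z v w u =
      fderiv ℝ (christoffel G) z u v w - fderiv ℝ (christoffel G) z v u w
        + christoffel G z u (christoffel G z v w) - christoffel G z v (christoffel G z u w) := by
  simp [curvatureEnd]

/-- The Ricci tensor of `g` at `p`: `Ric(v, w) = tr (u ↦ R(u, v) w)`, computed in the
chart at `p` (being a tensor, it does not depend on the chart; `v`, `w` are read in the chart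
through its differential). With this sign round spheres have positive Ricci curvature. -/
def ricci (g : BilinField I M) (p : M) (v w : TangentSpace I p) : ℝ :=
  LinearMap.trace ℝ E
    (curvatureEnd (chartMetric g p) (extChartAt I p p)
      (mfderiv I 𝓘(ℝ, E) (extChartAt I p) p v)
      (mfderiv I 𝓘(ℝ, E) (extChartAt I p) p w)).toLinearMap

/-- The Hessian `∇²u` of a function `u` at `p`, in the chart at `p`:
`(a, b) ↦ ∂_a ∂_b u - du(Γ(a, b))`. -/
def hessianChart (g : BilinField I M) (u : M → ℝ) (p : M) : E →L[ℝ] E →L[ℝ] ℝ :=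
  fderiv ℝ (fderiv ℝ (u ∘ (extChartAt I p).symm)) (extChartAt I p p)
    - (ContinuousLinearMap.compL ℝ E E ℝ
        (fderiv ℝ (u ∘ (extChartAt I p).symm) (extChartAt I p p))).comp
        (christoffel (chartMetric g p) (extChartAt I p p))

theorem hessianChart_apply (g : BilinField I M) (u : M → ℝ) (p : M) (a b : E) :
    hessianChart g u p a b =
      fderiv ℝ (fderiv ℝ (u ∘ (extChartAt I p).symm)) (extChartAt I p p) a b
        - fderiv ℝ (u ∘ (extChartAt I p).symm) (extChartAt I p p)
            (christoffel (chartMetric g p) (extChartAt I p p) a b) := rfl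

/-- The Laplace-Beltrami operator: the trace of the Hessian with respect to `g`,
that is `g^{ij} (∇²u)_{ij}`. -/
def laplacian (g : BilinField I M) (u : M → ℝ) (p : M) : ℝ :=
  LinearMap.trace ℝ E
    ((chartMetric g p (extChartAt I p p)).inverse.comp (hessianChart g u p)).toLinearMap

/-- The gradient of `u`: the vector with `g(grad u, ·) = du`. -/
def grad (g : BilinField I M) (u : M → ℝ) (p : M) : TangentSpace I p :=
  (g p).inverse (mvfderiv I u p)

/-- `|grad u|²` with respect to `g`. -/
def gradNormSq (g : BilinField I M) (u : M → ℝ) (p : M) : ℝ :=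
  g p (grad g u p) (grad g u p)

end Chart

section Warped

variable {E₁ : Type*} [NormedAddCommGroup E₁] [NormedSpace ℝ E₁]
  {H₁ : Type*} [TopologicalSpace H₁] {I₁ : ModelWithCorners ℝ E₁ H₁}
  {M₁ : Type*} [TopologicalSpace M₁] [ChartedSpace H₁ M₁]
  {E₂ : Type*} [NormedAddCommGroup E₂] [NormedSpace ℝ E₂]
  {H₂ : Type*} [TopologicalSpace H₂] {I₂ : ModelWithCorners ℝ E₂ H₂}
  {M₂ : Type*} [TopologicalSpace M₂] [ChartedSpace H₂ M₂]

/-- The warped product metric `g₁ ⊕ lam² g₂` on `M₁ × M₂`: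
`(X, Y) ↦ g₁(dπ₁ X, dπ₁ Y) + lam² g₂(dπ₂ X, dπ₂ Y)`. -/
def warpedProduct (g₁ : BilinField I₁ M₁) (lam : M₁ → ℝ) (g₂ : BilinField I₂ M₂) :
    BilinField (I₁.prod I₂) (M₁ × M₂) := fun p ↦
  pullbackForm (g₁ p.1) (mfderiv (I₁.prod I₂) I₁ Prod.fst p)
    + lam p.1 ^ 2 • pullbackForm (g₂ p.2) (mfderiv (I₁.prod I₂) I₂ Prod.snd p)

theorem warpedProduct_apply (g₁ : BilinField I₁ M₁) (lam : M₁ → ℝ) (g₂ : BilinField I₂ M₂)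
    (p : M₁ × M₂) (X Y : TangentSpace (I₁.prod I₂) p) :
    warpedProduct g₁ lam g₂ p X Y =
      g₁ p.1 (mfderiv (I₁.prod I₂) I₁ Prod.fst p X) (mfderiv (I₁.prod I₂) I₁ Prod.fst p Y)
        + lam p.1 ^ 2 * g₂ p.2 (mfderiv (I₁.prod I₂) I₂ Prod.snd p X)
            (mfderiv (I₁.prod I₂) I₂ Prod.snd p Y) := rfl

variable (I₁ I₂)

/-- The horizontal vector `(v, 0)` at `(x, y)`, the image of `v` under the inclusion of the leaf
`M₁ × {y}`. -/
def horiz (x : M₁) (y : M₂) (v : TangentSpace I₁ x) : TangentSpace (I₁.prod I₂) (x, y) :=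
  mfderiv I₁ (I₁.prod I₂) (fun x' : M₁ ↦ (x', y)) x v

/-- The vertical vector `(0, v)` at `(x, y)`, the image of `v` under the inclusion of the fiber
`{x} × M₂`. -/
def vert (x : M₁) (y : M₂) (v : TangentSpace I₂ y) : TangentSpace (I₁.prod I₂) (x, y) :=
  mfderiv I₂ (I₁.prod I₂) (fun y' : M₂ ↦ (x, y')) y v

/-- The frame `(∂_i, 0)`, `(0, ∂_α)` of `T_{(x,y)}(M₁ × M₂)` given by frames `(∂_i)` of `T_x M₁`
and `(∂_α)` of `T_y M₂`. -/
def prodFrame {ι κ : Type*} (x : M₁) (y : M₂) (b₁ : ι → TangentSpace I₁ x)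
    (b₂ : κ → TangentSpace I₂ y) : ι ⊕ κ → TangentSpace (I₁.prod I₂) (x, y) :=
  Sum.elim (fun i ↦ horiz I₁ I₂ x y (b₁ i)) (fun a ↦ vert I₁ I₂ x y (b₂ a))

end Warped

/-- The matrix `(B(e_i, e_j))` of a bilinear form in a frame `e`. -/
def gramMatrix {V ι : Type*} (B : V → V → ℝ) (e : ι → V) : Matrix ι ι ℝ :=
  Matrix.of fun i j ↦ B (e i) (e j)

end RiemGeom

end

/-!
The Ricci tensor at a point is computed in the preferred chart there, and the preferred chart of
`M₁ × M₂` at `(x, y)` is the product of the preferred charts of the factors. Hence everything takes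
place for a metric `G₁ ⊕ h G₂` on a product of two vector spaces, with `h = lam²`
(`chartMetric_warpedProduct`).

The Christoffel symbols of such a metric are explicit (`christoffel_flatWarped`):
`Γ(u, v) = (Γ₁(u₁, v₁) - ½ G₂(u₂, v₂) ∇h, Γ₂(u₂, v₂) + (dh(u₁) v₂ + dh(v₁) u₂) / (2h))`.
For vertical `v`, `w` the trace of `u ↦ R(u, v) w` is the sum of the traces of its two diagonal
blocks. The horizontal block contributes `-½ G₂(v, w) (Δh - |∇h|² / (2h))`, where `Δh` appears as
the trace of `u ↦ ∇_u grad h` (`inverse_comp_hessian`). The vertical block contributes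
`Ric₂(v, w) - ½ (m₂ - 1) G₂(v, w) |∇h|² / (2h)`. The sum is `trace_curvatureEnd_flatWarped`; with
`h = lam²` and `|∇h|² = 4 lam² |∇lam|²` it becomes `ricci_warpedProduct_vert`, and `Ric₂ = c g₂`
makes it a multiple of `lam² g₂`, the vertical part of the warped metric.

The trace formula for `f` follows from the proportionality, because the Gram matrix of a warped
product in a product frame is block diagonal, so that the vertical block of its inverse is the
inverse of its vertical block (`sum_inv_fromBlocks_mul`).
-/

open scoped Topology

noncomputable section

namespace RiemGeom

/-! ### Inner products and metrics on a vector space -/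

section Flat

variable {E : Type*} [NormedAddCommGroup E] [NormedSpace ℝ E]

/-- A continuous bilinear form that is symmetric and positive definite. -/
structure IsInnerForm {V : Type*} [AddCommGroup V] [Module ℝ V] [TopologicalSpace V]
    (B : V →L[ℝ] V →L[ℝ] ℝ) : Prop where
  symm : ∀ v w, B v w = B w v
  pos : ∀ v, v ≠ 0 → 0 < B v v

theorem IsInnerForm.ext {V : Type*} [AddCommGroup V] [Module ℝ V] [TopologicalSpace V]
    {B : V →L[ℝ] V →L[ℝ] ℝ} (hB : IsInnerForm B) {v w : V}
    (h : ∀ u, B v u = B w u) : v = w := by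
  by_contra hne
  have := hB.pos (v - w) (sub_ne_zero.2 hne)
  simp [h] at this

theorem IsInnerForm.isInvertible [FiniteDimensional ℝ E] {B : E →L[ℝ] E →L[ℝ] ℝ}
    (hB : IsInnerForm B) : B.IsInvertible := by
  have hinj : Function.Injective B.toLinearMap := fun v w h ↦ hB.ext fun u ↦ by
    have h' : B v = B w := h
    rw [h']
  have hdim : Module.finrank ℝ E = Module.finrank ℝ (E →L[ℝ] ℝ) := by
    rw [← (LinearMap.toContinuousLinearMap : (E →ₗ[ℝ] ℝ) ≃ₗ[ℝ] (E →L[ℝ] ℝ)).finrank_eq]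
    exact (Subspace.dual_finrank_eq (K := ℝ) (V := E)).symm
  exact ⟨(LinearEquiv.ofInjectiveOfFinrankEq B.toLinearMap hinj hdim).toContinuousLinearEquiv,
    by ext; rfl⟩

theorem IsInnerForm.apply_inverse [FiniteDimensional ℝ E] {B : E →L[ℝ] E →L[ℝ] ℝ}
    (hB : IsInnerForm B) (φ : E →L[ℝ] ℝ) (v : E) : B (B.inverse φ) v = φ v := by
  rw [hB.isInvertible.self_apply_inverse]

theorem IsInnerForm.eq_inverse [FiniteDimensional ℝ E] {B : E →L[ℝ] E →L[ℝ] ℝ}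
    (hB : IsInnerForm B) {φ : E →L[ℝ] ℝ} {v : E} (h : ∀ w, B v w = φ w) : B.inverse φ = v :=
  hB.ext fun w ↦ by rw [hB.apply_inverse, h]

theorem fderiv_clm_apply₂ {F W : Type*} [NormedAddCommGroup F] [NormedSpace ℝ F]
    [NormedAddCommGroup W] [NormedSpace ℝ W]
    {A : F → E →L[ℝ] E →L[ℝ] W} {z : F} (hA : DifferentiableAt ℝ A z) (u : F) (v w : E) :
    fderiv ℝ (fun z ↦ A z v w) z u = fderiv ℝ A z u v w := by
  have h := ((hA.hasFDerivAt.clm_apply (hasFDerivAt_const v z)).clm_apply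
    (hasFDerivAt_const w z)).fderiv
  rw [h]
  simp

theorem contDiffAt_christoffelLower {G : E → E →L[ℝ] E →L[ℝ] ℝ} {z : E}
    (hG : ContDiffAt ℝ 2 G z) : ContDiffAt ℝ 1 (christoffelLower G) z := by
  have h := hG.fderiv_right (m := 1) (by norm_num)
  have hflip : ContDiffAt ℝ 1 (fun z ↦ (fderiv ℝ G z).flip) z :=
    (ContinuousLinearMap.flipₗᵢ ℝ E E (E →L[ℝ] ℝ)).contDiff.contDiffAt.comp z h
  have hcycle : ContDiffAt ℝ 1 (fun z ↦ cycleForm (fderiv ℝ G z)) z :=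
    (contDiffAt_const (c :=
      (ContinuousLinearMap.flipₗᵢ ℝ E E ℝ).toContinuousLinearEquiv.toContinuousLinearMap)).clm_comp
      hflip
  exact ((h.add hflip).sub hcycle).const_smul (1 / 2 : ℝ)

theorem contDiffAt_inverse_metric [FiniteDimensional ℝ E] {G : E → E →L[ℝ] E →L[ℝ] ℝ} {z : E}
    {n : ℕ∞ω} (hG : ContDiffAt ℝ n G z) (hz : IsInnerForm (G z)) :
    ContDiffAt ℝ n (fun z ↦ (G z).inverse) z :=
  haveI : CompleteSpace E := FiniteDimensional.complete ℝ E
  (hz.isInvertible.contDiffAt_map_inverse).comp z hG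

theorem contDiffAt_christoffel [FiniteDimensional ℝ E] {G : E → E →L[ℝ] E →L[ℝ] ℝ} {z : E}
    (hG : ContDiffAt ℝ 2 G z) (hz : IsInnerForm (G z)) : ContDiffAt ℝ 1 (christoffel G) z := by
  have hinv := contDiffAt_inverse_metric (hG.of_le (m := 1) (by norm_num)) hz
  exact (((ContinuousLinearMap.compL ℝ E (E →L[ℝ] ℝ) E).contDiff.contDiffAt).comp z
    hinv).clm_comp (contDiffAt_christoffelLower hG)

theorem apply_christoffel [FiniteDimensional ℝ E] {G : E → E →L[ℝ] E →L[ℝ] ℝ} {z : E}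
    (hz : IsInnerForm (G z)) (u v w : E) :
    G z (christoffel G z u v) w =
      1 / 2 * (fderiv ℝ G z u v w + fderiv ℝ G z v u w - fderiv ℝ G z w u v) := by
  rw [christoffel_apply, hz.apply_inverse, christoffelLower_apply]

/-- The derivative of a field of symmetric forms is symmetric. -/
theorem fderiv_metric_symm {F : Type*} [NormedAddCommGroup F] [NormedSpace ℝ F]
    {G : F → E →L[ℝ] E →L[ℝ] ℝ} {z : F} (hG : DifferentiableAt ℝ G z)
    (hsymm : ∀ᶠ x in 𝓝 z, IsInnerForm (G x)) (u : F) (v w : E) :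
    fderiv ℝ G z u v w = fderiv ℝ G z u w v := by
  rw [← fderiv_clm_apply₂ hG, ← fderiv_clm_apply₂ hG]
  have : (fun x ↦ G x v w) =ᶠ[𝓝 z] fun x ↦ G x w v := hsymm.mono fun x hx ↦ hx.symm v w
  rw [this.fderiv_eq]

/-- The gradient field `G⁻¹ dh` of a function on a vector space with metric `G`. -/
def flatGrad (G : E → E →L[ℝ] E →L[ℝ] ℝ) (h : E → ℝ) (z : E) : E :=
  (G z).inverse (fderiv ℝ h z)

theorem contDiffAt_flatGrad [FiniteDimensional ℝ E] {G : E → E →L[ℝ] E →L[ℝ] ℝ} {h : E → ℝ}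
    {z : E} (hG : ContDiffAt ℝ 2 G z) (hz : IsInnerForm (G z)) (hh : ContDiffAt ℝ 2 h z) :
    ContDiffAt ℝ 1 (flatGrad G h) z :=
  (contDiffAt_inverse_metric (hG.of_le (m := 1) (by norm_num)) hz).clm_apply
    (hh.fderiv_right (m := 1) (by norm_num))

/-- Raising an index of the Hessian `D²h - dh ∘ Γ` gives the covariant derivative
`u ↦ ∇_u grad h` of the gradient. -/
theorem inverse_comp_hessian [FiniteDimensional ℝ E] {G : E → E →L[ℝ] E →L[ℝ] ℝ} {h : E → ℝ}
    {z : E} (hG : ContDiffAt ℝ 2 G z) (hinner : ∀ᶠ x in 𝓝 z, IsInnerForm (G x))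
    (hh : ContDiffAt ℝ 2 h z) :
    (G z).inverse.comp (fderiv ℝ (fderiv ℝ h) z
        - (ContinuousLinearMap.compL ℝ E E ℝ (fderiv ℝ h z)).comp (christoffel G z))
      = fderiv ℝ (flatGrad G h) z + (christoffel G z).flip (flatGrad G h z) := by
  have hz := hinner.self_of_nhds
  have hGd := hG.differentiableAt (by norm_num)
  have had := (contDiffAt_flatGrad hG hz hh).differentiableAt (by norm_num)
  have hdh := (hh.fderiv_right (m := 1) (by norm_num)).differentiableAt (by norm_num)
  refine ContinuousLinearMap.ext fun u ↦ hz.eq_inverse fun w ↦ ?_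
  change _ = fderiv ℝ (fderiv ℝ h) z u w - fderiv ℝ h z (christoffel G z u w)
  -- differentiate the defining relation `G (grad h, w) = dh w`
  have key : fderiv ℝ G z u (flatGrad G h z) w + G z (fderiv ℝ (flatGrad G h) z u) w
      = fderiv ℝ (fderiv ℝ h) z u w := by
    have h1 := ((hGd.hasFDerivAt.clm_apply had.hasFDerivAt).clm_apply
      (hasFDerivAt_const w z)).fderiv
    have h2 := (hdh.hasFDerivAt.clm_apply (hasFDerivAt_const w z)).fderiv
    have h3 : (fun x ↦ G x (flatGrad G h x) w) =ᶠ[𝓝 z] fun x ↦ fderiv ℝ h x w :=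
      hinner.mono fun x hx ↦ hx.apply_inverse _ _
    rw [h3.fderiv_eq, h2] at h1
    have := DFunLike.congr_fun h1 u
    simp at this
    linarith
  have hdhG : ∀ v, fderiv ℝ h z v = G z v (flatGrad G h z) := fun v ↦ by
    rw [hz.symm, flatGrad, hz.apply_inverse]
  rw [add_apply, ContinuousLinearMap.flip_apply, map_add, add_apply, ← key, hdhG,
    apply_christoffel hz, apply_christoffel hz]
  have s := fderiv_metric_symm hGd hinner
  rw [s u w, s w u]
  ring

theorem trace_prod {V W : Type*} [AddCommGroup V] [Module ℝ V] [FiniteDimensional ℝ V]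
    [AddCommGroup W] [Module ℝ W] [FiniteDimensional ℝ W] (A : V × W →ₗ[ℝ] V × W) :
    LinearMap.trace ℝ (V × W) A =
      LinearMap.trace ℝ V (LinearMap.fst ℝ V W ∘ₗ A ∘ₗ LinearMap.inl ℝ V W)
        + LinearMap.trace ℝ W (LinearMap.snd ℝ V W ∘ₗ A ∘ₗ LinearMap.inr ℝ V W) := by
  have hA : A = (A ∘ₗ LinearMap.inl ℝ V W) ∘ₗ LinearMap.fst ℝ V W
      + (A ∘ₗ LinearMap.inr ℝ V W) ∘ₗ LinearMap.snd ℝ V W := by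
    refine LinearMap.ext fun p ↦ ?_
    simp [← map_add]
  conv_lhs => rw [hA]
  rw [map_add, LinearMap.trace_comp_comm' (A ∘ₗ LinearMap.inl ℝ V W),
    LinearMap.trace_comp_comm' (A ∘ₗ LinearMap.inr ℝ V W)]

end Flat

/-! ### Curvature of a warped product of two metrics on vector spaces -/

section FlatWarped

variable {E₁ : Type*} [NormedAddCommGroup E₁] [NormedSpace ℝ E₁]
  {E₂ : Type*} [NormedAddCommGroup E₂] [NormedSpace ℝ E₂]

/-- The warped product `G₁ ⊕ h G₂` of two metrics on vector spaces. The factor in front of `G₂`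
is `h`, not its square. -/
def flatWarped (G₁ : E₁ → E₁ →L[ℝ] E₁ →L[ℝ] ℝ) (h : E₁ → ℝ) (G₂ : E₂ → E₂ →L[ℝ] E₂ →L[ℝ] ℝ)
    (z : E₁ × E₂) : (E₁ × E₂) →L[ℝ] (E₁ × E₂) →L[ℝ] ℝ :=
  pullbackForm (G₁ z.1) (ContinuousLinearMap.fst ℝ E₁ E₂)
    + h z.1 • pullbackForm (G₂ z.2) (ContinuousLinearMap.snd ℝ E₁ E₂)

variable {G₁ : E₁ → E₁ →L[ℝ] E₁ →L[ℝ] ℝ} {h : E₁ → ℝ} {G₂ : E₂ → E₂ →L[ℝ] E₂ →L[ℝ] ℝ}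

theorem flatWarped_apply (z u v : E₁ × E₂) :
    flatWarped G₁ h G₂ z u v = G₁ z.1 u.1 v.1 + h z.1 * G₂ z.2 u.2 v.2 := rfl

theorem IsInnerForm.flatWarped {z : E₁ × E₂} (h₁ : IsInnerForm (G₁ z.1)) (hh : 0 < h z.1)
    (h₂ : IsInnerForm (G₂ z.2)) : IsInnerForm (flatWarped G₁ h G₂ z) where
  symm v w := by rw [flatWarped_apply, flatWarped_apply, h₁.symm, h₂.symm]
  pos v hv := by
    rw [flatWarped_apply]
    have n₁ : 0 ≤ G₁ z.1 v.1 v.1 := by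
      by_cases h0 : v.1 = 0
      · simp [h0]
      · exact (h₁.pos _ h0).le
    by_cases h0 : v.2 = 0
    · have : v.1 ≠ 0 := fun h1 ↦ hv (Prod.ext h1 h0)
      simpa [h0] using h₁.pos _ this
    · have := mul_pos hh (h₂.pos _ h0)
      linarith

theorem contDiffAt_flatWarped {n : ℕ∞ω} {z : E₁ × E₂} (h₁ : ContDiffAt ℝ n G₁ z.1)
    (hh : ContDiffAt ℝ n h z.1) (h₂ : ContDiffAt ℝ n G₂ z.2) :
    ContDiffAt ℝ n (flatWarped G₁ h G₂) z := by
  have c1 : ContDiffAt ℝ n (fun z : E₁ × E₂ ↦ G₁ z.1) z := h₁.comp z contDiffAt_fst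
  have ch : ContDiffAt ℝ n (fun z : E₁ × E₂ ↦ h z.1) z := hh.comp z contDiffAt_fst
  have c2 : ContDiffAt ℝ n (fun z : E₁ × E₂ ↦ G₂ z.2) z := h₂.comp z contDiffAt_snd
  exact (contDiffAt_const.clm_comp (c1.clm_comp contDiffAt_const)).add
    (ch.smul (contDiffAt_const.clm_comp (c2.clm_comp contDiffAt_const)))

theorem fderiv_flatWarped {z : E₁ × E₂} (h₁ : DifferentiableAt ℝ G₁ z.1)
    (hh : DifferentiableAt ℝ h z.1) (h₂ : DifferentiableAt ℝ G₂ z.2) (u v w : E₁ × E₂) :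
    fderiv ℝ (flatWarped G₁ h G₂) z u v w =
      fderiv ℝ G₁ z.1 u.1 v.1 w.1 + fderiv ℝ h z.1 u.1 * G₂ z.2 v.2 w.2
        + h z.1 * fderiv ℝ G₂ z.2 u.2 v.2 w.2 := by
  have c1 : HasFDerivAt (fun z : E₁ × E₂ ↦ G₁ z.1) _ z :=
    h₁.hasFDerivAt.comp z (hasFDerivAt_fst (𝕜 := ℝ))
  have ch : HasFDerivAt (fun z : E₁ × E₂ ↦ h z.1) _ z :=
    hh.hasFDerivAt.comp z (hasFDerivAt_fst (𝕜 := ℝ))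
  have c2 : HasFDerivAt (fun z : E₁ × E₂ ↦ G₂ z.2) _ z :=
    h₂.hasFDerivAt.comp z (hasFDerivAt_snd (𝕜 := ℝ))
  have hd : DifferentiableAt ℝ (flatWarped G₁ h G₂) z :=
    (((hasFDerivAt_const _ z).clm_comp (c1.clm_comp (hasFDerivAt_const _ z))).add
      (ch.smul ((hasFDerivAt_const _ z).clm_comp
        (c2.clm_comp (hasFDerivAt_const _ z))))).differentiableAt
  rw [← fderiv_clm_apply₂ hd]
  have H := ((c1.clm_apply (hasFDerivAt_const v.1 z)).clm_apply (hasFDerivAt_const w.1 z)).add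
    (ch.mul ((c2.clm_apply (hasFDerivAt_const v.2 z)).clm_apply (hasFDerivAt_const w.2 z)))
  have H' := H.fderiv
  have e : (fun z ↦ flatWarped G₁ h G₂ z v w) =
    (fun z : E₁ × E₂ ↦ G₁ z.1 v.1 w.1) + ((fun z : E₁ × E₂ ↦ h z.1) *
      fun z : E₁ × E₂ ↦ G₂ z.2 v.2 w.2) := rfl
  rw [e, H']
  simp
  ring

variable [FiniteDimensional ℝ E₁] [FiniteDimensional ℝ E₂]

/-- The Christoffel symbols of a warped product:
`Γ(u, v) = (Γ₁(u₁, v₁) - ½ G₂(u₂, v₂) ∇h, Γ₂(u₂, v₂) + (dh(u₁) v₂ + dh(v₁) u₂) / (2h))`. -/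
theorem christoffel_flatWarped {z : E₁ × E₂} (hd₁ : DifferentiableAt ℝ G₁ z.1)
    (hdh : DifferentiableAt ℝ h z.1) (hd₂ : DifferentiableAt ℝ G₂ z.2)
    (h₁ : IsInnerForm (G₁ z.1)) (hh : 0 < h z.1) (h₂ : IsInnerForm (G₂ z.2)) (u v : E₁ × E₂) :
    christoffel (flatWarped G₁ h G₂) z u v =
      (christoffel G₁ z.1 u.1 v.1 - (1 / 2 * G₂ z.2 u.2 v.2) • flatGrad G₁ h z.1,
       christoffel G₂ z.2 u.2 v.2
        + (1 / (2 * h z.1)) • (fderiv ℝ h z.1 u.1 • v.2 + fderiv ℝ h z.1 v.1 • u.2)) := by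
  rw [christoffel_apply]
  refine (h₁.flatWarped hh h₂).eq_inverse fun w ↦ ?_
  rw [christoffelLower_apply, flatWarped_apply]
  simp only [fderiv_flatWarped hd₁ hdh hd₂, map_sub, map_add, map_smul,
    sub_apply, add_apply, smul_apply,
    apply_christoffel h₁, apply_christoffel h₂, smul_eq_mul, flatGrad, h₁.apply_inverse]
  field_simp
  ring

/-- The vertical part of the Ricci tensor of a warped product `G₁ ⊕ h G₂`, in coordinates:
`Ric(v, w) = Ric₂(v, w) - ½ (Δh + (m₂ - 2) |∇h|² / (2h)) G₂(v, w)`, where `Δh` is the trace of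
the raised Hessian and `|∇h|² = dh(∇h)`. -/
theorem trace_curvatureEnd_flatWarped {z : E₁ × E₂} (hd₁ : ContDiffAt ℝ 2 G₁ z.1)
    (hdh : ContDiffAt ℝ 2 h z.1) (hd₂ : ContDiffAt ℝ 2 G₂ z.2)
    (h₁ : ∀ᶠ x in 𝓝 z.1, IsInnerForm (G₁ x)) (hh : 0 < h z.1)
    (h₂ : ∀ᶠ y in 𝓝 z.2, IsInnerForm (G₂ y)) (v w : E₂) :
    LinearMap.trace ℝ (E₁ × E₂)
        (curvatureEnd (flatWarped G₁ h G₂) z (0, v) (0, w)).toLinearMap =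
      LinearMap.trace ℝ E₂ (curvatureEnd G₂ z.2 v w).toLinearMap
        - 1 / 2 * (LinearMap.trace ℝ E₁ ((G₁ z.1).inverse.comp (fderiv ℝ (fderiv ℝ h) z.1
            - (ContinuousLinearMap.compL ℝ E₁ E₁ ℝ (fderiv ℝ h z.1)).comp
                (christoffel G₁ z.1))).toLinearMap
          + (Module.finrank ℝ E₂ - 2) * (fderiv ℝ h z.1 (flatGrad G₁ h z.1) / (2 * h z.1)))
          * G₂ z.2 v w := by
  obtain ⟨x, y⟩ := z
  dsimp only at *
  have i₁ := h₁.self_of_nhds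
  have i₂ := h₂.self_of_nhds
  set Γ := christoffel (flatWarped G₁ h G₂) with hΓ
  set a := flatGrad G₁ h with ha
  -- the formula for the connection holds in a neighbourhood, along each factor
  have ev₁ : ∀ᶠ x' in 𝓝 x, ∀ u v, Γ (x', y) u v =
      (christoffel G₁ x' u.1 v.1 - (1 / 2 * G₂ y u.2 v.2) • a x', christoffel G₂ y u.2 v.2
        + (1 / (2 * h x')) • (fderiv ℝ h x' u.1 • v.2 + fderiv ℝ h x' v.1 • u.2)) := by
    have e₁ : ∀ᶠ x' in 𝓝 x, ContDiffAt ℝ 2 G₁ x' := hd₁.eventually (by simp)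
    have e₂ : ∀ᶠ x' in 𝓝 x, ContDiffAt ℝ 2 h x' := hdh.eventually (by simp)
    have e₃ : ∀ᶠ x' in 𝓝 x, 0 < h x' := hdh.continuousAt.eventually_const_lt hh
    filter_upwards [e₁, e₂, e₃, h₁] with x' e₁ e₂ e₃ e₄
    exact christoffel_flatWarped (z := (x', y)) (e₁.differentiableAt (by norm_num))
      (e₂.differentiableAt (by norm_num)) (hd₂.differentiableAt (by norm_num)) e₄ e₃ i₂
  have ev₂ : ∀ᶠ y' in 𝓝 y, ∀ u v, Γ (x, y') u v =
      (christoffel G₁ x u.1 v.1 - (1 / 2 * G₂ y' u.2 v.2) • a x, christoffel G₂ y' u.2 v.2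
        + (1 / (2 * h x)) • (fderiv ℝ h x u.1 • v.2 + fderiv ℝ h x v.1 • u.2)) := by
    have e₁ : ∀ᶠ y' in 𝓝 y, ContDiffAt ℝ 2 G₂ y' := hd₂.eventually (by simp)
    filter_upwards [e₁, h₂] with y' e₁ e₂
    exact christoffel_flatWarped (z := (x, y')) (hd₁.differentiableAt (by norm_num))
      (hdh.differentiableAt (by norm_num)) (e₁.differentiableAt (by norm_num)) i₁ hh e₂
  have hΓxy := ev₂.self_of_nhds
  have dΓ : DifferentiableAt ℝ Γ (x, y) :=
    (contDiffAt_christoffel (contDiffAt_flatWarped hd₁ hdh hd₂)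
      (IsInnerForm.flatWarped (z := (x, y)) i₁ hh i₂)).differentiableAt (by norm_num)
  have dΓ₂ : DifferentiableAt ℝ (christoffel G₂) y :=
    (contDiffAt_christoffel hd₂ i₂).differentiableAt (by norm_num)
  have da : DifferentiableAt ℝ a x :=
    (contDiffAt_flatGrad hd₁ i₁ hdh).differentiableAt (by norm_num)
  have along₁ : ∀ (u : E₁) (V W : E₁ × E₂),
      fderiv ℝ Γ (x, y) (u, 0) V W = fderiv ℝ (fun x' ↦ Γ (x', y) V W) x u := fun u V W ↦ by
    have hc : HasFDerivAt (fun x' : E₁ ↦ Γ (x', y)) _ x :=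
      HasFDerivAt.comp (f := fun x' ↦ (x', y)) (g := Γ) x dΓ.hasFDerivAt
        (hasFDerivAt_prodMk_left x y)
    rw [fderiv_clm_apply₂ hc.differentiableAt, hc.fderiv]
    simp
  have along₂ : ∀ (u : E₂) (V W : E₁ × E₂),
      fderiv ℝ Γ (x, y) (0, u) V W = fderiv ℝ (fun y' ↦ Γ (x, y') V W) y u := fun u V W ↦ by
    have hc : HasFDerivAt (fun y' : E₂ ↦ Γ (x, y')) _ y :=
      HasFDerivAt.comp (f := fun y' ↦ (x, y')) (g := Γ) y dΓ.hasFDerivAt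
        (hasFDerivAt_prodMk_right x y)
    rw [fderiv_clm_apply₂ hc.differentiableAt, hc.fderiv]
    simp
  have D₁ : ∀ u, fderiv ℝ Γ (x, y) (u, 0) (0, v) (0, w)
      = (-(1 / 2 * G₂ y v w) • fderiv ℝ a x u, 0) := fun u ↦ by
    rw [along₁]
    have : (fun x' ↦ Γ (x', y) (0, v) (0, w)) =ᶠ[𝓝 x]
        fun x' ↦ (-(1 / 2 * G₂ y v w) • a x', christoffel G₂ y v w) :=
      ev₁.mono fun x' hx ↦ by simp [hx, ha]
    have d : HasFDerivAt (fun x' ↦ -(1 / 2 * G₂ y v w) • a x') _ x :=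
      da.hasFDerivAt.const_smul (-(1 / 2 * G₂ y v w))
    rw [this.fderiv_eq, (d.prodMk (hasFDerivAt_const _ x)).fderiv]
    simp
  have D₂ : ∀ u, fderiv ℝ Γ (x, y) (0, v) (u, 0) (0, w) = 0 := fun u ↦ by
    rw [along₂]
    have : (fun y' ↦ Γ (x, y') (u, 0) (0, w)) =ᶠ[𝓝 y]
        fun y' ↦ (0, (1 / (2 * h x)) • fderiv ℝ h x u • w) :=
      ev₂.mono fun x' hx ↦ by simp [hx]
    rw [this.fderiv_eq]
    simp
  have D₃ : ∀ u v w, (fderiv ℝ Γ (x, y) (0, u) (0, v) (0, w)).2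
      = fderiv ℝ (christoffel G₂) y u v w := fun u v w ↦ by
    rw [along₂]
    have dG : DifferentiableAt ℝ G₂ y := hd₂.differentiableAt (by norm_num)
    have e : (fun y' ↦ Γ (x, y') (0, v) (0, w)) =ᶠ[𝓝 y]
        fun y' ↦ (-(1 / 2 * G₂ y' v w) • a x, christoffel G₂ y' v w) :=
      ev₂.mono fun x' hx ↦ by simp [hx, ha]
    have d₁ : DifferentiableAt ℝ (fun y' ↦ -(1 / 2 * G₂ y' v w) • a x) y := by fun_prop
    have d₂ : DifferentiableAt ℝ (fun y' ↦ christoffel G₂ y' v w) y := by fun_prop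
    rw [e.fderiv_eq, (d₁.hasFDerivAt.prodMk d₂.hasFDerivAt).fderiv, ← fderiv_clm_apply₂ dΓ₂]
    rfl
  rw [trace_prod]
  -- horizontal block of `u ↦ R(u, v) w`: a multiple of `∇ grad h`, plus a rank one term
  have T₁ : LinearMap.fst ℝ E₁ E₂ ∘ₗ
        (curvatureEnd (flatWarped G₁ h G₂) (x, y) (0, v) (0, w)).toLinearMap ∘ₗ
          LinearMap.inl ℝ E₁ E₂
      = (-(1 / 2 * G₂ y v w)) • (fderiv ℝ a x + (christoffel G₁ x).flip (a x)).toLinearMap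
        + (1 / 2 * G₂ y v w / (2 * h x)) • (fderiv ℝ h x).toLinearMap.smulRight (a x) := by
    ext u
    simp only [LinearMap.comp_apply, LinearMap.inl_apply, ContinuousLinearMap.coe_coe,
      curvatureEnd_apply, ← hΓ, D₁, D₂, LinearMap.fst_apply]
    simp [hΓxy]
    module
  -- vertical block: the curvature of the fibre, a multiple of the identity, and a rank one term
  have T₂ : LinearMap.snd ℝ E₁ E₂ ∘ₗ
        (curvatureEnd (flatWarped G₁ h G₂) (x, y) (0, v) (0, w)).toLinearMap ∘ₗ
          LinearMap.inr ℝ E₁ E₂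
      = (curvatureEnd G₂ y v w).toLinearMap
        + (fderiv ℝ h x (a x) / (2 * h x)) • ((-(1 / 2 * G₂ y v w)) • LinearMap.id
          + (1 / 2 : ℝ) • (G₂ y w).toLinearMap.smulRight v) := by
    ext u
    simp only [LinearMap.comp_apply, LinearMap.inr_apply, ContinuousLinearMap.coe_coe,
      curvatureEnd_apply, ← hΓ, LinearMap.snd_apply, Prod.snd_add, Prod.snd_sub, D₃,
      LinearMap.add_apply]
    simp [hΓxy, i₂.symm u w]
    module
  rw [T₁, T₂, inverse_comp_hessian hd₁ h₁ hdh]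
  simp only [map_add, map_smul, LinearMap.trace_smulRight, LinearMap.trace_id, smul_eq_mul,
    ContinuousLinearMap.coe_coe, ContinuousLinearMap.toLinearMap_add, ← ha]
  rw [i₂.symm w v]
  ring

end FlatWarped

/-! ### Metrics read in charts -/

theorem curvatureEnd_congr {E : Type*} [NormedAddCommGroup E] [NormedSpace ℝ E]
    {G G' : E → E →L[ℝ] E →L[ℝ] ℝ} {z : E} (h : G =ᶠ[𝓝 z] G') (v w : E) :
    curvatureEnd G z v w = curvatureEnd G' z v w := by
  have hΓ : christoffel G =ᶠ[𝓝 z] christoffel G' := by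
    filter_upwards [h, h.fderiv (𝕜 := ℝ)] with x hx hx'
    simp only [christoffel, christoffelLower, hx, hx']
  simp only [curvatureEnd, hΓ.fderiv_eq, hΓ.self_of_nhds]

section Chart

variable {E : Type*} [NormedAddCommGroup E] [NormedSpace ℝ E]
  {H : Type*} [TopologicalSpace H] {I : ModelWithCorners ℝ E H}
  {M : Type*} [TopologicalSpace M] [ChartedSpace H M]

/-- The chart differentials in the definition of `ricci` are identities. -/
theorem ricci_eq [IsManifold I 1 M] (g : BilinField I M) (p : M) (v w : TangentSpace I p) :
    ricci g p v w = LinearMap.trace ℝ E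
      (curvatureEnd (chartMetric g p) (extChartAt I p p) v w).toLinearMap := by
  have h : ∀ D : E →L[ℝ] E, D = ContinuousLinearMap.id ℝ E →
      LinearMap.trace ℝ E
        (curvatureEnd (chartMetric g p) (extChartAt I p p) (D v) (D w)).toLinearMap =
      LinearMap.trace ℝ E
        (curvatureEnd (chartMetric g p) (extChartAt I p p) v w).toLinearMap := by
    rintro _ rfl; rfl
  exact h _ mfderiv_extChartAt_self

variable [I.Boundaryless]

theorem fderiv_comp_extChartAt_symm {u : M → ℝ} {p : M} (hu : MDifferentiableAt I 𝓘(ℝ, ℝ) u p) :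
    fderiv ℝ (u ∘ (extChartAt I p).symm) (extChartAt I p p) = mvfderiv I u p := by
  ext v
  simp only [mvfderiv, mfderiv, hu, I.range_eq_univ, fderivWithin_univ]
  rfl

section

variable [IsManifold I 1 M]

theorem mdifferentiableAt_extChartAt_symm {p : M} {z : E} (hz : z ∈ (extChartAt I p).target) :
    MDifferentiableAt 𝓘(ℝ, E) I (extChartAt I p).symm z := by
  have := mdifferentiableWithinAt_extChartAt_symm hz
  rwa [I.range_eq_univ, mdifferentiableWithinAt_univ] at this

theorem isInvertible_mfderiv_extChartAt_symm {p : M} {z : E}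
    (hz : z ∈ (extChartAt I p).target) :
    (mfderiv 𝓘(ℝ, E) I (extChartAt I p).symm z).IsInvertible := by
  have := isInvertible_mfderivWithin_extChartAt_symm hz
  rwa [I.range_eq_univ, mfderivWithin_univ] at this

theorem mfderiv_extChartAt_symm_self (p : M) :
    mfderiv 𝓘(ℝ, E) I (extChartAt I p).symm (extChartAt I p p) = ContinuousLinearMap.id ℝ E := by
  have := mfderivWithin_range_extChartAt_symm (I := I) (x := p)
  rwa [I.range_eq_univ, mfderivWithin_univ] at this

/-- At the centre of the chart, the metric in the chart is the metric, because the differential of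
the preferred chart at its centre is the identity. -/
theorem chartMetric_self (g : BilinField I M) (p : M) :
    chartMetric g p (extChartAt I p p) = g p := by
  -- the tangent spaces at different points are all `E`, so the fields can be compared there
  have h : ∀ q : M, q = p → (g q : E →L[ℝ] E →L[ℝ] ℝ) = g p := by rintro q rfl; rfl
  ext u v
  rw [chartMetric_apply, mfderiv_extChartAt_symm_self]
  exact congrArg (fun B : E →L[ℝ] E →L[ℝ] ℝ ↦ B u v) (h _ (extChartAt_to_inv p))

theorem isInnerForm_chartMetric {g : BilinField I M} (hg : ∀ q, IsInnerForm (g q)) {p : M} {z : E}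
    (hz : z ∈ (extChartAt I p).target) : IsInnerForm (chartMetric g p z) where
  symm _ _ := (hg _).symm _ _
  pos _ hv := (hg _).pos _ fun h ↦
    hv ((isInvertible_mfderiv_extChartAt_symm hz).injective (h.trans (map_zero _).symm))

/-- The gradient, read in the preferred chart at its base point. -/
theorem flatGrad_chartMetric {g : BilinField I M} {u : M → ℝ} {p : M}
    (hu : MDifferentiableAt I 𝓘(ℝ, ℝ) u p) :
    flatGrad (chartMetric g p) (u ∘ (extChartAt I p).symm) (extChartAt I p p) = grad g u p := by
  rw [flatGrad, chartMetric_self, fderiv_comp_extChartAt_symm hu]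
  rfl

end

/-- A smooth metric is smooth in charts: its coefficients are its values on the smooth vector
fields `z ↦ dφ⁻¹_z u`. -/
theorem contDiffAt_chartMetric [FiniteDimensional ℝ E] [IsManifold I ∞ M]
    (g : Bundle.ContMDiffRiemannianMetric I ∞ E (fun x : M ↦ TangentSpace I x)) {p : M} {z : E}
    (hz : z ∈ (extChartAt I p).target) : ContDiffAt ℝ 2 (chartMetric g.inner p) z := by
  have hopen := isOpen_extChartAt_target (I := I) p
  have hsymm : ContMDiffOn 𝓘(ℝ, E) I ∞ (extChartAt I p).symm (extChartAt I p).target :=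
    contMDiffOn_extChartAt_symm p
  -- the field `z ↦ dφ⁻¹_z u` is the tangent map of `φ⁻¹` on the constant field `u`
  have hvec : ∀ u : E, ContMDiffOn 𝓘(ℝ, E) I.tangent 2
      (fun z ↦ (⟨(extChartAt I p).symm z, mfderiv 𝓘(ℝ, E) I (extChartAt I p).symm z u⟩ :
        TangentBundle I M)) (extChartAt I p).target := fun u ↦ by
    have ht := hsymm.contMDiffOn_tangentMapWithin (m := 2) (by norm_cast)
      hopen.uniqueMDiffOn
    have hc : ContMDiff 𝓘(ℝ, E) 𝓘(ℝ, E).tangent 2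
        (fun z ↦ (⟨z, u⟩ : TangentBundle 𝓘(ℝ, E) E)) :=
      contMDiff_vectorSpace_iff_contDiff.2 contDiff_const
    refine (ht.comp hc.contMDiffOn fun z hz ↦ hz).congr fun z hz ↦ ?_
    simp only [Function.comp, tangentMapWithin, mfderivWithin_of_isOpen hopen hz]
  have hscal : ∀ u v : E, ContDiffOn ℝ 2 (fun z ↦ chartMetric g.inner p z u v)
      (extChartAt I p).target := fun u v ↦ by
    have hg : ContMDiffOn 𝓘(ℝ, E) (I.prod 𝓘(ℝ, E →L[ℝ] E →L[ℝ] ℝ)) 2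
      (fun z ↦ Bundle.TotalSpace.mk' (E →L[ℝ] E →L[ℝ] ℝ)
        (E := fun x : M ↦ TangentSpace I x →L[ℝ] TangentSpace I x →L[ℝ] ℝ)
        ((extChartAt I p).symm z) (g.inner ((extChartAt I p).symm z))) (extChartAt I p).target :=
      ((g.contMDiff.of_le (by norm_cast)).comp_contMDiffOn (hsymm.of_le (by norm_cast)))
    have := ContMDiffOn.clm_bundle_apply₂ (F₁ := E) (F₂ := E) (F₃ := ℝ)
      (E₃ := Bundle.Trivial M ℝ) hg (hvec u) (hvec v)
    intro z hz
    have hz := this z hz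
    simp only [Bundle.contMDiffWithinAt_totalSpace] at hz
    exact contMDiffWithinAt_iff_contDiffWithinAt.1 hz.2
  have : ContDiffOn ℝ 2 (chartMetric g.inner p) (extChartAt I p).target :=
    contDiffOn_clm_apply.2 fun u ↦ contDiffOn_clm_apply.2 fun v ↦ hscal u v
  exact this.contDiffAt (hopen.mem_nhds hz)

end Chart

/-! ### The warped product in a product chart -/

section Warped

variable {E₁ : Type*} [NormedAddCommGroup E₁] [NormedSpace ℝ E₁]
  {H₁ : Type*} [TopologicalSpace H₁] {I₁ : ModelWithCorners ℝ E₁ H₁}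
  {M₁ : Type*} [TopologicalSpace M₁] [ChartedSpace H₁ M₁]
  {E₂ : Type*} [NormedAddCommGroup E₂] [NormedSpace ℝ E₂]
  {H₂ : Type*} [TopologicalSpace H₂] {I₂ : ModelWithCorners ℝ E₂ H₂}
  {M₂ : Type*} [TopologicalSpace M₂] [ChartedSpace H₂ M₂]

theorem warpedProduct_vert (g₁ : BilinField I₁ M₁) (lam : M₁ → ℝ) (g₂ : BilinField I₂ M₂)
    (x : M₁) (y : M₂) (v w : TangentSpace I₂ y) :
    warpedProduct g₁ lam g₂ (x, y) (vert I₁ I₂ x y v) (vert I₁ I₂ x y w)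
      = lam x ^ 2 * g₂ y v w := by
  rw [warpedProduct_apply, vert, vert, mfderiv_prod_right, mfderiv_fst, mfderiv_snd]
  change g₁ x (0 : TangentSpace I₁ x) (0 : TangentSpace I₁ x) + lam x ^ 2 * g₂ y v w = _
  simp

theorem warpedProduct_horiz (g₁ : BilinField I₁ M₁) (lam : M₁ → ℝ) (g₂ : BilinField I₂ M₂)
    (x : M₁) (y : M₂) (v w : TangentSpace I₁ x) :
    warpedProduct g₁ lam g₂ (x, y) (horiz I₁ I₂ x y v) (horiz I₁ I₂ x y w) = g₁ x v w := by
  rw [warpedProduct_apply, horiz, horiz, mfderiv_prod_left, mfderiv_fst, mfderiv_snd]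
  change g₁ x v w + lam x ^ 2 * g₂ y (0 : TangentSpace I₂ y) (0 : TangentSpace I₂ y) = _
  simp

theorem warpedProduct_horiz_vert (g₁ : BilinField I₁ M₁) (lam : M₁ → ℝ) (g₂ : BilinField I₂ M₂)
    (x : M₁) (y : M₂) (v : TangentSpace I₁ x) (w : TangentSpace I₂ y) :
    warpedProduct g₁ lam g₂ (x, y) (horiz I₁ I₂ x y v) (vert I₁ I₂ x y w) = 0 := by
  rw [warpedProduct_apply, horiz, vert, mfderiv_prod_left, mfderiv_prod_right, mfderiv_fst,
    mfderiv_snd]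
  change g₁ x v (0 : TangentSpace I₁ x) + lam x ^ 2 * g₂ y (0 : TangentSpace I₂ y) w = _
  simp

theorem warpedProduct_vert_horiz (g₁ : BilinField I₁ M₁) (lam : M₁ → ℝ) (g₂ : BilinField I₂ M₂)
    (x : M₁) (y : M₂) (v : TangentSpace I₂ y) (w : TangentSpace I₁ x) :
    warpedProduct g₁ lam g₂ (x, y) (vert I₁ I₂ x y v) (horiz I₁ I₂ x y w) = 0 := by
  rw [warpedProduct_apply, horiz, vert, mfderiv_prod_left, mfderiv_prod_right, mfderiv_fst,
    mfderiv_snd]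
  change g₁ x (0 : TangentSpace I₁ x) w + lam x ^ 2 * g₂ y v (0 : TangentSpace I₂ y) = _
  simp

/-- In the product chart, the warped product is the warped product of the metrics read in charts. -/
theorem chartMetric_warpedProduct [I₁.Boundaryless] [IsManifold I₁ 1 M₁]
    [I₂.Boundaryless] [IsManifold I₂ 1 M₂]
    (g₁ : BilinField I₁ M₁) (lam : M₁ → ℝ) (g₂ : BilinField I₂ M₂) (x : M₁) (y : M₂) {z : E₁ × E₂} (h₁ : z.1 ∈ (extChartAt I₁ x).target)
    (h₂ : z.2 ∈ (extChartAt I₂ y).target) :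
    chartMetric (warpedProduct g₁ lam g₂) (x, y) z =
      flatWarped (chartMetric g₁ x) ((fun x' ↦ lam x' ^ 2) ∘ (extChartAt I₁ x).symm)
        (chartMetric g₂ y) z := by
  have hs : ((extChartAt (I₁.prod I₂) (x, y)).symm : E₁ × E₂ → M₁ × M₂) =
      Prod.map (extChartAt I₁ x).symm (extChartAt I₂ y).symm := by
    rw [extChartAt_prod]; rfl
  have hd : HasMFDerivAt 𝓘(ℝ, E₁ × E₂) (I₁.prod I₂)
      (Prod.map (extChartAt I₁ x).symm (extChartAt I₂ y).symm) z
      ((mfderiv 𝓘(ℝ, E₁) I₁ (extChartAt I₁ x).symm z.1).prodMap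
        (mfderiv 𝓘(ℝ, E₂) I₂ (extChartAt I₂ y).symm z.2)) := by
    rw [modelWithCornersSelf_prod, ← chartedSpaceSelf_prod]
    exact (mdifferentiableAt_extChartAt_symm h₁).hasMFDerivAt.prodMap
      (mdifferentiableAt_extChartAt_symm h₂).hasMFDerivAt
  refine ContinuousLinearMap.ext fun u ↦ ContinuousLinearMap.ext fun v ↦ ?_
  have key : ∀ s : E₁ × E₂ → M₁ × M₂, s = Prod.map (extChartAt I₁ x).symm (extChartAt I₂ y).symm →
      warpedProduct g₁ lam g₂ (s z) (mfderiv 𝓘(ℝ, E₁ × E₂) (I₁.prod I₂) s z u)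
        (mfderiv 𝓘(ℝ, E₁ × E₂) (I₁.prod I₂) s z v) =
      flatWarped (chartMetric g₁ x) ((fun x' ↦ lam x' ^ 2) ∘ (extChartAt I₁ x).symm)
        (chartMetric g₂ y) z u v := by
    rintro _ rfl
    rw [warpedProduct_apply, mfderiv_fst, mfderiv_snd, hd.mfderiv]
    rfl
  exact key _ hs

end Warped

/-! ### Gram matrices -/

/-- The Gram matrix of an inner product in a basis is invertible. -/
theorem IsInnerForm.isUnit_det_gramMatrix {V ι : Type*} [AddCommGroup V] [Module ℝ V]
    [TopologicalSpace V] [Fintype ι] [DecidableEq ι] {B : V →L[ℝ] V →L[ℝ] ℝ} (hB : IsInnerForm B)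
    (b : Module.Basis ι ℝ V) : IsUnit (gramMatrix (fun v w ↦ B v w) b).det := by
  rw [isUnit_iff_ne_zero]
  intro h0
  obtain ⟨c, hc, hc0⟩ := Matrix.exists_mulVec_eq_zero_iff.2 h0
  have hsum : ∑ i, c i • b i ≠ 0 := fun h ↦
    hc (funext fun i ↦ Fintype.linearIndependent_iff.1 b.linearIndependent c h i)
  have hpos := hB.pos _ hsum
  have hrow : ∀ i, B (b i) (∑ j, c j • b j) = 0 := fun i ↦ by
    have := congrFun hc0 i
    simp only [Matrix.mulVec, dotProduct, gramMatrix, Matrix.of_apply, Pi.zero_apply] at this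
    simp only [map_sum, map_smul, smul_eq_mul, ← this, mul_comm]
  have : B (∑ i, c i • b i) (∑ j, c j • b j) = 0 := by
    rw [hB.symm, map_sum]
    refine Finset.sum_eq_zero fun i _ ↦ ?_
    rw [map_smul, hB.symm, hrow, smul_zero]
  exact hpos.ne' this

/-- Tracing `f • S` with the lower right block of the inverse of `fromBlocks A 0 0 S` gives
`f` times the size of `S`. -/
theorem sum_inv_fromBlocks_mul {ι κ : Type*} [Fintype ι] [DecidableEq ι] [Fintype κ]
    [DecidableEq κ] {A : Matrix ι ι ℝ} {S : Matrix κ κ ℝ} (hA : IsUnit A.det) (hS : IsUnit S.det)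
    (hsymm : S.IsSymm) (f : ℝ) :
    ∑ α, ∑ β, (Matrix.fromBlocks A 0 0 S)⁻¹ (Sum.inr α) (Sum.inr β) * (f * S α β)
      = f * Fintype.card κ := by
  have hinv : (Matrix.fromBlocks A 0 0 S)⁻¹ = Matrix.fromBlocks A⁻¹ 0 0 S⁻¹ := by
    refine Matrix.inv_eq_right_inv ?_
    rw [Matrix.fromBlocks_multiply]
    simp [Matrix.mul_nonsing_inv _ hA, Matrix.mul_nonsing_inv _ hS, Matrix.fromBlocks_one]
  have htr : ∑ α, ∑ β, S⁻¹ α β * S β α = Fintype.card κ := by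
    have := congrArg Matrix.trace (Matrix.nonsing_inv_mul S hS)
    simpa [Matrix.trace, Matrix.mul_apply] using this
  rw [hinv, ← htr, Finset.mul_sum]
  refine Finset.sum_congr rfl fun α _ ↦ ?_
  rw [Finset.mul_sum]
  refine Finset.sum_congr rfl fun β _ ↦ ?_
  rw [Matrix.fromBlocks_apply₂₂, hsymm.apply]
  ring

/-! ### Vertical Ricci curvature of a warped product -/

section RicciWarped

variable {E₁ : Type*} [NormedAddCommGroup E₁] [NormedSpace ℝ E₁]
  {H₁ : Type*} [TopologicalSpace H₁] {I₁ : ModelWithCorners ℝ E₁ H₁}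
  {M₁ : Type*} [TopologicalSpace M₁] [ChartedSpace H₁ M₁]

theorem mvfderiv_sq {u : M₁ → ℝ} {x : M₁} (hu : MDifferentiableAt I₁ 𝓘(ℝ, ℝ) u x) :
    mvfderiv I₁ (fun x' ↦ u x' ^ 2) x = (2 * u x) • mvfderiv I₁ u x := by
  have : (fun x' ↦ u x' ^ 2) = fun x' ↦ u x' * u x' := funext fun _ ↦ sq _
  rw [this, mvfderiv_fun_mul hu hu]
  module

variable [IsManifold I₁ ∞ M₁]

theorem _root_.Bundle.ContMDiffRiemannianMetric.isInnerForm
    (g : Bundle.ContMDiffRiemannianMetric I₁ ∞ E₁ (fun x : M₁ ↦ TangentSpace I₁ x)) (x : M₁) :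
    IsInnerForm (g.inner x) :=
  ⟨g.symm x, g.pos x⟩

variable [FiniteDimensional ℝ E₁] [I₁.Boundaryless]
  {E₂ : Type*} [NormedAddCommGroup E₂] [NormedSpace ℝ E₂] [FiniteDimensional ℝ E₂]
  {H₂ : Type*} [TopologicalSpace H₂] {I₂ : ModelWithCorners ℝ E₂ H₂} [I₂.Boundaryless]
  {M₂ : Type*} [TopologicalSpace M₂] [ChartedSpace H₂ M₂] [IsManifold I₂ ∞ M₂]

/-- The vertical Ricci curvature of `g₁ ⊕ lam² g₂`. It is
`Ric₂ - (½ Δ lam² + (m₂ - 2) |grad lam|²) g₂`, the coordinate formula with `h = lam²`, since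
`|grad lam²|² / (2 lam²) = 2 |grad lam|²`. -/
theorem ricci_warpedProduct_vert
    (g₁ : Bundle.ContMDiffRiemannianMetric I₁ ∞ E₁ (fun x : M₁ ↦ TangentSpace I₁ x))
    (g₂ : Bundle.ContMDiffRiemannianMetric I₂ ∞ E₂ (fun y : M₂ ↦ TangentSpace I₂ y))
    {lam : M₁ → ℝ} (hlam : ContMDiff I₁ 𝓘(ℝ, ℝ) ∞ lam) (x : M₁) (y : M₂) (hpos : 0 < lam x)
    (v w : TangentSpace I₂ y) :
    ricci (warpedProduct g₁.inner lam g₂.inner) (x, y) (vert I₁ I₂ x y v) (vert I₁ I₂ x y w) =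
      ricci g₂.inner y v w - 1 / 2 * (laplacian g₁.inner (fun x' ↦ lam x' ^ 2) x
        + 2 * (Module.finrank ℝ E₂ - 2) * gradNormSq g₁.inner lam x) * g₂.inner y v w := by
  have hx := mem_extChartAt_target (I := I₁) x
  have hy := mem_extChartAt_target (I := I₂) y
  have nx := (isOpen_extChartAt_target (I := I₁) x).mem_nhds hx
  have ny := (isOpen_extChartAt_target (I := I₂) y).mem_nhds hy
  set z : E₁ × E₂ := (extChartAt I₁ x x, extChartAt I₂ y y) with hz
  set h : M₁ → ℝ := fun x' ↦ lam x' ^ 2 with hh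
  have hsmooth : ContMDiff I₁ 𝓘(ℝ, ℝ) ∞ h := hlam.pow 2
  have hval : (h ∘ (extChartAt I₁ x).symm) z.1 = lam x ^ 2 := by simp [hh, hz]
  have hchart : ContDiffAt ℝ 2 (h ∘ (extChartAt I₁ x).symm) z.1 :=
    ((hsmooth.comp_contMDiffOn (contMDiffOn_extChartAt_symm x)).contDiffOn.contDiffAt nx).of_le
      (by norm_cast)
  have hlamd : MDifferentiableAt I₁ 𝓘(ℝ, ℝ) lam x := hlam.mdifferentiableAt (by simp)
  have hhd : MDifferentiableAt I₁ 𝓘(ℝ, ℝ) h x := hsmooth.mdifferentiableAt (by simp)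
  have hz' : extChartAt (I₁.prod I₂) (x, y) (x, y) = z := by rw [extChartAt_prod]; rfl
  have hG : chartMetric (warpedProduct g₁.inner lam g₂.inner) (x, y) =ᶠ[𝓝 z]
      flatWarped (chartMetric g₁.inner x) (h ∘ (extChartAt I₁ x).symm) (chartMetric g₂.inner y) := by
    filter_upwards [prod_mem_nhds nx ny] with z' hz'
    exact chartMetric_warpedProduct _ _ _ _ _ hz'.1 hz'.2
  have hvert : ∀ v : TangentSpace I₂ y, vert I₁ I₂ x y v = ((0, v) : E₁ × E₂) := fun v ↦ by
    rw [vert, mfderiv_prod_right]; rfl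
  have hgrad : fderiv ℝ (h ∘ (extChartAt I₁ x).symm) z.1
        (flatGrad (chartMetric g₁.inner x) (h ∘ (extChartAt I₁ x).symm) z.1)
      = 4 * lam x ^ 2 * gradNormSq g₁.inner lam x := by
    have hnorm : gradNormSq g₁.inner lam x =
        mvfderiv I₁ lam x ((g₁.inner x).inverse (mvfderiv I₁ lam x)) :=
      IsInnerForm.apply_inverse (E := E₁) (g₁.isInnerForm x) _ _
    have hsmul : ∀ (φ : E₁ →L[ℝ] ℝ) (A : (E₁ →L[ℝ] ℝ) →L[ℝ] E₁) (a N : ℝ), N = φ (A φ) →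
        (a • φ) (A (a • φ)) = a ^ 2 * N := by
      rintro φ A a _ rfl
      simp only [map_smul, smul_apply, smul_eq_mul]
      ring
    rw [flatGrad_chartMetric hhd, fderiv_comp_extChartAt_symm hhd, grad, mvfderiv_sq hlamd]
    exact (hsmul _ _ _ _ hnorm).trans (by ring)
  have hmetric : chartMetric g₂.inner y z.2 v w = g₂.inner y v w := by
    rw [hz, chartMetric_self]
    rfl
  have htrace := trace_curvatureEnd_flatWarped (z := z) (contDiffAt_chartMetric g₁ hx) hchart
    (contDiffAt_chartMetric g₂ hy)
    (Filter.eventually_of_mem nx fun _ h ↦ isInnerForm_chartMetric g₁.isInnerForm h)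
    (by rw [hval]; positivity)
    (Filter.eventually_of_mem ny fun _ h ↦ isInnerForm_chartMetric g₂.isInnerForm h) v w
  rw [← curvatureEnd_congr hG, hgrad, hval, hmetric] at htrace
  rw [ricci_eq, hvert, hvert, hz', htrace, ricci_eq, laplacian, hessianChart]
  have := hpos.ne'
  field_simp
  ring

end RicciWarped

end RiemGeom

end

theorem lemma5p5 {m₁ m₂ : ℕ} (hm₂ : 1 ≤ m₂)
    {M₁ : Type*} [TopologicalSpace M₁] [ChartedSpace (EuclideanSpace ℝ (Fin m₁)) M₁]
    [IsManifold (𝓡 m₁) ∞ M₁]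
    {M₂ : Type*} [TopologicalSpace M₂] [ChartedSpace (EuclideanSpace ℝ (Fin m₂)) M₂]
    [IsManifold (𝓡 m₂) ∞ M₂]
    {T : Set ℝ}
    (g₁ : T → Bundle.ContMDiffRiemannianMetric (𝓡 m₁) ∞ (EuclideanSpace ℝ (Fin m₁))
      (fun x : M₁ ↦ TangentSpace (𝓡 m₁) x))
    (g₂ : T → Bundle.ContMDiffRiemannianMetric (𝓡 m₂) ∞ (EuclideanSpace ℝ (Fin m₂))
      (fun y : M₂ ↦ TangentSpace (𝓡 m₂) y))
    (lam : T → M₁ → ℝ)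
    (hlam : ∀ t, ContMDiff (𝓡 m₁) 𝓘(ℝ, ℝ) ∞ (lam t))
    (hpos : ∀ t x, 0 < lam t x)
    (c : ℝ)
    (hEinstein : ∀ t (y : M₂) (v w : TangentSpace (𝓡 m₂) y),
      RiemGeom.ricci (g₂ t).inner y v w = c * (g₂ t).inner y v w) :
    ∃ f : M₁ → T → ℝ,
      -- the vertical components of the Ricci tensor
      (∀ (t : T) (x : M₁) (y : M₂) (v w : TangentSpace (𝓡 m₂) y),
        RiemGeom.ricci (RiemGeom.warpedProduct (g₁ t).inner (lam t) (g₂ t).inner) (x, y)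
            (RiemGeom.vert (𝓡 m₁) (𝓡 m₂) x y v) (RiemGeom.vert (𝓡 m₁) (𝓡 m₂) x y w)
          = f x t * RiemGeom.warpedProduct (g₁ t).inner (lam t) (g₂ t).inner (x, y)
              (RiemGeom.vert (𝓡 m₁) (𝓡 m₂) x y v) (RiemGeom.vert (𝓡 m₁) (𝓡 m₂) x y w)) ∧
      -- `f` as the normalized vertical trace, in arbitrary frames of the two factors
      (∀ (t : T) (x : M₁) (y : M₂) (b₁ : Module.Basis (Fin m₁) ℝ (TangentSpace (𝓡 m₁) x))
          (b₂ : Module.Basis (Fin m₂) ℝ (TangentSpace (𝓡 m₂) y)),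
        f x t = 1 / (m₂ : ℝ) * ∑ α : Fin m₂, ∑ β : Fin m₂,
          (RiemGeom.gramMatrix
            (fun V W ↦ RiemGeom.warpedProduct (g₁ t).inner (lam t) (g₂ t).inner (x, y) V W)
            (RiemGeom.prodFrame (𝓡 m₁) (𝓡 m₂) x y b₁ b₂))⁻¹ (Sum.inr α) (Sum.inr β)
          * RiemGeom.ricci (RiemGeom.warpedProduct (g₁ t).inner (lam t) (g₂ t).inner) (x, y)
              (RiemGeom.vert (𝓡 m₁) (𝓡 m₂) x y (b₂ α))
              (RiemGeom.vert (𝓡 m₁) (𝓡 m₂) x y (b₂ β))) ∧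
      -- the explicit formula for `f`
      (∀ (t : T) (x : M₁),
        f x t = 1 / (2 * lam t x ^ 2) *
          ((4 - 2 * (m₂ : ℝ)) * RiemGeom.gradNormSq (g₁ t).inner (lam t) x
            - RiemGeom.laplacian (g₁ t).inner (fun x' ↦ lam t x' ^ 2) x + 2 * c)) := by
  refine ⟨fun x t ↦ 1 / (2 * lam t x ^ 2) *
    ((4 - 2 * (m₂ : ℝ)) * RiemGeom.gradNormSq (g₁ t).inner (lam t) x
      - RiemGeom.laplacian (g₁ t).inner (fun x' ↦ lam t x' ^ 2) x + 2 * c), ?_⟩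
  have hvert : ∀ (t : T) (x : M₁) (y : M₂) (v w : TangentSpace (𝓡 m₂) y),
      RiemGeom.ricci (RiemGeom.warpedProduct (g₁ t).inner (lam t) (g₂ t).inner) (x, y)
          (RiemGeom.vert (𝓡 m₁) (𝓡 m₂) x y v) (RiemGeom.vert (𝓡 m₁) (𝓡 m₂) x y w)
        = 1 / (2 * lam t x ^ 2) *
          ((4 - 2 * (m₂ : ℝ)) * RiemGeom.gradNormSq (g₁ t).inner (lam t) x
            - RiemGeom.laplacian (g₁ t).inner (fun x' ↦ lam t x' ^ 2) x + 2 * c)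
          * RiemGeom.warpedProduct (g₁ t).inner (lam t) (g₂ t).inner (x, y)
            (RiemGeom.vert (𝓡 m₁) (𝓡 m₂) x y v) (RiemGeom.vert (𝓡 m₁) (𝓡 m₂) x y w) := by
    intro t x y v w
    rw [RiemGeom.ricci_warpedProduct_vert _ _ (hlam t) x y (hpos t x), hEinstein,
      RiemGeom.warpedProduct_vert, finrank_euclideanSpace_fin]
    have := (hpos t x).ne'
    field_simp
    ring
  refine ⟨hvert, fun t x y b₁ b₂ ↦ ?_, fun t x ↦ rfl⟩
  have hm : (m₂ : ℝ) ≠ 0 := by positivity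
  have hblocks : RiemGeom.gramMatrix
      (fun V W ↦ RiemGeom.warpedProduct (g₁ t).inner (lam t) (g₂ t).inner (x, y) V W)
      (RiemGeom.prodFrame (𝓡 m₁) (𝓡 m₂) x y b₁ b₂) =
    Matrix.fromBlocks (RiemGeom.gramMatrix (fun v w ↦ (g₁ t).inner x v w) b₁) 0 0
      (lam t x ^ 2 • RiemGeom.gramMatrix (fun v w ↦ (g₂ t).inner y v w) b₂) := by
    ext i j
    rcases i with i | i <;> rcases j with j | j
    · exact RiemGeom.warpedProduct_horiz _ _ _ _ _ _ _
    · exact RiemGeom.warpedProduct_horiz_vert _ _ _ _ _ _ _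
    · exact RiemGeom.warpedProduct_vert_horiz _ _ _ _ _ _ _
    · exact RiemGeom.warpedProduct_vert _ _ _ _ _ _ _
  have hS : IsUnit (lam t x ^ 2 • RiemGeom.gramMatrix (fun v w ↦ (g₂ t).inner y v w) b₂).det := by
    rw [Matrix.det_smul]
    exact (IsUnit.mk0 _ (pow_ne_zero _ (pow_ne_zero _ (hpos t x).ne'))).mul
      (((g₂ t).isInnerForm y).isUnit_det_gramMatrix b₂)
  have hsymm : (lam t x ^ 2 • RiemGeom.gramMatrix (fun v w ↦ (g₂ t).inner y v w) b₂).IsSymm :=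
    Matrix.IsSymm.ext fun i j ↦ congrArg (lam t x ^ 2 * ·) ((g₂ t).symm y _ _)
  have hentry : ∀ α β, RiemGeom.warpedProduct (g₁ t).inner (lam t) (g₂ t).inner (x, y)
      (RiemGeom.vert (𝓡 m₁) (𝓡 m₂) x y (b₂ α)) (RiemGeom.vert (𝓡 m₁) (𝓡 m₂) x y (b₂ β)) =
      (lam t x ^ 2 • RiemGeom.gramMatrix (fun v w ↦ (g₂ t).inner y v w) b₂) α β :=
    fun α β ↦ RiemGeom.warpedProduct_vert _ _ _ _ _ _ _
  simp only [hvert, hblocks, hentry]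
  rw [RiemGeom.sum_inv_fromBlocks_mul (((g₁ t).isInnerForm x).isUnit_det_gramMatrix b₁) hS hsymm,
    Fintype.card_fin]
  field_simp
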